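/- Let $n\ge p\ge 1$ and let $F_1,\dots,F_p\in\mathbb{Q}[X_1,\dots,X_n]$ be a regular sequence such that the ideal $(F_1,\dots,F_p)$ is the ideal of definition of $S:=\{x\in\mathbb{C}^n : F_1(x)=\cdots=F_p(x)=0\}$, i.e. the set of all polynomials of $\mathbb{Q}[X_1,\dots,X_n]$ vanishing on $S$. Let $J(F_1,\dots,F_p):=\left[\frac{\partial F_k}{\partial X_l}\right]_{1\le k\le p,\,1\le l\le n}$ be the Jacobian and call a point of $S$ regular if the Jacobian has rank $p$ there. Let $S_{\mathbb{R}}:=S\cap\mathbb{R}^n$. For $1\le i\le n-p$ and a complex $((n-p-i+1)\times(n+1))$-matrix $\alpha=[a_{k,l}]_{1\le k\le n-p-i+1,\;0\le l\le n}$, let the $i$-th dual polar variety $W_{\overline{K}^{n-p-i}(\alpha)}(S)$ be the Zariski closure in $\mathbb{C}^n$ of the set of regular points of $S$ at which all $(n-i+1)$-minors of the $((n-i+1)\times n)$-matrix $$\begin{bmatrix} & J(F_1,\dots,F_p) & \\ a_{1,1}-a_{1,0}X_1 & \cdots & a_{1,n}-a_{1,0}X_n\\ \vdots & & \vdots\\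 a_{n-p-i+1,1}-a_{n-p-i+1,0}X_1 & \cdots & a_{n-p-i+1,n}-a_{n-p-i+1,0}X_n\end{bmatrix}$$ vanish. For an $((n-p-i+1)\times n)$-matrix $a$ write $\overline{a}$ for the matrix obtained from $a$ by adding a column number $0$ all of whose entries are $1$. "Generic" is understood in the sense of Thom. A statement $P$ about complex $((n-p-i+1)\times n)$-matrices $a$ (for instance, a statement about the variety $W_{\overline{K}^{n-p-i}(\overline{a})}(S)$) is said to hold generically if there is a non-empty Zariski open set $O$ of full-rank matrices, in $\mathbb{C}^{(n-p-i+1)\times n}$ or in $\mathbb{R}^{(n-p-i+1)\times n}$, such that $P$ holds for every $a\in O$. That $W_{\overline{K}^{n-p-i}(\overline{a})}(S)$ is generic means that $a$ satisfies a prescribed, arbitrary statement $P$ that holds generically. **Corollary.** Suppose that $S_{\mathbb{R}}$ contains a regular point of $S$, and let $1\le i\le n-p$. Then for every statement $P$ that holds generically there is a non-empty subset $O^{(i)}$ of $\mathbb{R}^{(n-p-i+1)\times n}$, open in the Euclidean topology, such that every matrix $a\in O^{(i)}$ has maximal rank $n-p-i+1$, satisfies $P$, and is such that the dual polar variety $W_{\overline{K}^{n-p-i}(\overline{a})}(S)$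 is non-empty. In other words, for every $a\in O^{(i)}$ the matrix $a$ has maximal rank and $W_{\overline{K}^{n-p-i}(\overline{a})}(S)$ is generic and non-empty. -/

import Mathlib

namespace PolarVariety

open MvPolynomial

/-- The complex affine variety `S = {F₁ = 0, …, F_p = 0}` in `ℂⁿ`. -/
def variety {n p : ℕ} (F : Fin p → MvPolynomial (Fin n) ℚ) : Set (Fin n → ℂ) :=
  {x | ∀ k, aeval x (F k) = 0}

/-- `F₁, …, F_p` is a regular sequence in `ℚ[X₁, …, X_n]`, and the ideal it generates is the ideal
of definition of its zero set `S`, that is, the ideal of all polynomials of `ℚ[X₁, …, X_n]` that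
vanish on `S`. -/
structure IsReducedRegularSequence {n p : ℕ} (F : Fin p → MvPolynomial (Fin n) ℚ) : Prop where
  isRegular : RingTheory.Sequence.IsRegular (MvPolynomial (Fin n) ℚ) (List.ofFn F)
  vanishingIdeal_eq : vanishingIdeal ℚ (variety F) = Ideal.span (Set.range F)

/-- The Jacobian `J(F₁, …, F_p)` at the point `x`, a complex `p × n` matrix. -/
noncomputable def jacobian {n p : ℕ} (F : Fin p → MvPolynomial (Fin n) ℚ) (x : Fin n → ℂ) :
    Matrix (Fin p) (Fin n) ℂ :=
  Matrix.of fun k l => aeval x (pderiv l (F k))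

/-- The regular points of `S`: the points of `S` where the Jacobian has maximal rank `p`. -/
def regularPoints {n p : ℕ} (F : Fin p → MvPolynomial (Fin n) ℚ) : Set (Fin n → ℂ) :=
  {x | x ∈ variety F ∧ (jacobian F x).rank = p}

/-- The `(p + m) × n` matrix whose first `p` rows are the Jacobian at `x` and whose last `m` rows
are `(a_{k,1} - a_{k,0} x₁, …, a_{k,n} - a_{k,0} x_n)`, for an `m × (n + 1)` matrix
`α = [a_{k,l}]` with columns numbered from `0` to `n`. -/
noncomputable def dualPolarMatrix {n p m : ℕ} (F : Fin p → MvPolynomial (Fin n) ℚ)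
    (α : Matrix (Fin m) (Fin (n + 1)) ℂ) (x : Fin n → ℂ) :
    Matrix (Fin p ⊕ Fin m) (Fin n) ℂ :=
  Matrix.fromRows (jacobian F x) (Matrix.of fun k l => α k l.succ - α k 0 * x l)

/-- Zariski closure in `ℂⁿ`: the common zeros of all polynomials vanishing on `Y`. -/
noncomputable def zariskiClosure {n : ℕ} (Y : Set (Fin n → ℂ)) : Set (Fin n → ℂ) :=
  zeroLocus ℂ (vanishingIdeal ℂ Y)

/-- The dual polar variety of `S` given by the `m × (n + 1)` matrix `α`: the Zariski closure of the
set of regular points of `S` where all `(p + m)`-minors of the `(p + m) × n` matrix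
`dualPolarMatrix F α x` vanish. For `m = n - p - i + 1` this is the `i`-th dual polar variety,
and `p + m = n - i + 1`. -/
noncomputable def dualPolarVariety {n p m : ℕ} (F : Fin p → MvPolynomial (Fin n) ℚ)
    (α : Matrix (Fin m) (Fin (n + 1)) ℂ) : Set (Fin n → ℂ) :=
  zariskiClosure {x | x ∈ regularPoints F ∧
    ∀ c : (Fin p ⊕ Fin m) ↪ Fin n, ((dualPolarMatrix F α x).submatrix id c).det = 0}

/-- The `m × (n + 1)` matrix obtained from `a` by adding a column number `0` of ones. -/
def addOnes {m n : ℕ} (a : Matrix (Fin m) (Fin n) ℂ) : Matrix (Fin m) (Fin (n + 1)) ℂ :=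
  Matrix.of fun k => Fin.cons 1 (a k)

/-- A real matrix, viewed as a complex one. -/
noncomputable def complexify {m n : ℕ} (a : Matrix (Fin m) (Fin n) ℝ) :
    Matrix (Fin m) (Fin n) ℂ :=
  a.map Complex.ofReal

/-- Zariski open subsets of the affine space of `m × n` matrices over `K`: complements of the
common zero sets of families of polynomials over `K` in the matrix entries. -/
def IsZariskiOpen {m n : ℕ} {K : Type*} [Field K] (O : Set (Matrix (Fin m) (Fin n) K)) : Prop :=
  ∃ T : Set (MvPolynomial (Fin m × Fin n) K),
    O = {a | ∃ f ∈ T, eval (fun e : Fin m × Fin n => a e.1 e.2) f ≠ 0}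

/-- `P` is a statement which is valid for generic polar varieties: there is a non-empty Zariski
open set `O` of full-rank matrices, in the complex or in the real affine space of `m × n`
matrices, such that `P` holds for all `a ∈ O`. (A statement about the polar variety defined by
the matrix `a` is in particular a statement about `a`.) -/
def HoldsGenerically {m n : ℕ} (P : Matrix (Fin m) (Fin n) ℂ → Prop) : Prop :=
  (∃ O : Set (Matrix (Fin m) (Fin n) ℂ), IsZariskiOpen O ∧ O.Nonempty ∧
      ∀ a ∈ O, a.rank = m ∧ P a) ∨
  (∃ O : Set (Matrix (Fin m) (Fin n) ℝ), IsZariskiOpen O ∧ O.Nonempty ∧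
      ∀ a ∈ O, a.rank = m ∧ P (complexify a))

end PolarVariety

namespace PolarVariety

open MvPolynomial

/-! Let `x₀` be a real regular point and let some row `b` of `a` be close to `x₀`. A real point `x`
of `S` nearest to `b` is then close to `x₀`, hence regular, because maximal rank is an open
condition. By Lagrange multipliers, the gradients at `x` and `b - x` are dependent. The column of
ones makes `b - x` a row of the polar matrix, so `x` lies on the polar variety. Thus one row in a
small ball suffices. Genericity only removes the zeros of a nonzero polynomial, which cannot contain
a non-empty Euclidean open set of real matrices. -/

/-- A matrix has maximal rank if and only if its rows are linearly independent. -/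
theorem linearIndependent_row_iff_rank_eq {K : Type*} [Field K] {m n : ℕ}
    (M : Matrix (Fin m) (Fin n) K) : LinearIndependent K M.row ↔ M.rank = m := by
  rw [linearIndependent_iff_card_eq_finrank_span, M.rank_eq_finrank_span_row, Fintype.card_fin,
    Set.finrank, eq_comm]

theorem rank_eq_of_rank_complexify {m n : ℕ} {a : Matrix (Fin m) (Fin n) ℝ}
    (h : (complexify a).rank = m) : a.rank = m := by
  rw [← linearIndependent_row_iff_rank_eq] at h ⊢
  have h' : LinearIndependent ℝ (complexify a).row :=
    h.restrict_scalars' ℝ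
  let φ : (Fin n → ℝ) →ₗ[ℝ] (Fin n → ℂ) := Complex.ofRealCLM.toLinearMap.compLeft (Fin n)
  exact LinearIndependent.of_comp φ h'

/-- A generic property holds at all real matrices outside of a complex algebraic hypersurface. -/
theorem HoldsGenerically.exists_ne_zero {m n : ℕ} {P : Matrix (Fin m) (Fin n) ℂ → Prop}
    (hP : HoldsGenerically P) :
    ∃ f : MvPolynomial (Fin m × Fin n) ℂ, f ≠ 0 ∧ ∀ a : Matrix (Fin m) (Fin n) ℝ,
      eval (fun e => (a e.1 e.2 : ℂ)) f ≠ 0 → a.rank = m ∧ P (complexify a) := by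
  rcases hP with ⟨O, ⟨T, rfl⟩, ⟨b, f, hfT, hf⟩, hO⟩ | ⟨O, ⟨T, rfl⟩, ⟨b, f, hfT, hf⟩, hO⟩
  · refine ⟨f, ?_, fun a ha => ?_⟩
    · rintro rfl
      simp at hf
    · obtain ⟨h₁, h₂⟩ := hO (complexify a) ⟨f, hfT, ha⟩
      exact ⟨rank_eq_of_rank_complexify h₁, h₂⟩
  -- A real Zariski open set is cut out by the same polynomial read over `ℂ`, so both notions of
  -- genericity reduce to one complex `f`.
  · refine ⟨map Complex.ofRealHom f, ?_, fun a ha => hO a ⟨f, hfT, ?_⟩⟩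
    · rw [Ne, map_eq_zero_iff _ (map_injective _ Complex.ofRealHom.injective)]
      rintro rfl
      simp at hf
    · intro h
      apply ha
      rw [eval_map]
      have := eval₂_comp_left Complex.ofRealHom (RingHom.id ℝ) (fun e => a e.1 e.2) f
      rw [← eval₂_id] at h
      rw [h, map_zero] at this
      exact this.symm

/-- A nonzero complex polynomial does not vanish identically on a non-empty product of
infinite sets of reals. -/
theorem exists_eval_ofReal_ne_zero {σ : Type*} {f : MvPolynomial σ ℂ} (hf : f ≠ 0)
    (s : σ → Set ℝ) (hs : ∀ e, (s e).Infinite) :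
    ∃ y : σ → ℝ, (∀ e, y e ∈ s e) ∧ eval (fun e => (y e : ℂ)) f ≠ 0 := by
  by_contra! h
  have hs' : ∀ e, ((fun t : ℝ => (t : ℂ)) '' s e).Infinite := fun e =>
    (hs e).image Complex.ofReal_injective.injOn
  refine hf (funext_set (fun e => (fun t : ℝ => (t : ℂ)) '' s e) hs' fun x hx => ?_)
  choose y hy hyx using fun e => hx e (Set.mem_univ e)
  obtain rfl : (fun e => (y e : ℂ)) = x := _root_.funext hyx
  rw [h y hy, map_zero]

theorem continuous_aeval_ofReal {n : ℕ} (f : MvPolynomial (Fin n) ℚ) :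
    Continuous fun x : EuclideanSpace ℝ (Fin n) => aeval (fun l => (x l : ℂ)) f := by
  induction f using MvPolynomial.induction_on with
  | C a => simpa using continuous_const
  | add f g hf hg => simp only [map_add]; exact hf.add hg
  | mul_X f l hf =>
    simp only [map_mul, aeval_X]
    exact hf.mul (Complex.continuous_ofReal.comp (by fun_prop))

/-- The real points of maximal rank form a Euclidean open set. -/
theorem isOpen_setOf_rank_jacobian {n p : ℕ} (F : Fin p → MvPolynomial (Fin n) ℚ) :
    IsOpen {x : EuclideanSpace ℝ (Fin n) | (jacobian F fun l => (x l : ℂ)).rank = p} := by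
  simp_rw [← linearIndependent_row_iff_rank_eq]
  refine (isOpen_setOfPred_linearIndependent (𝕜 := ℂ) (E := Fin n → ℂ) (ι := Fin p)).preimage ?_
  exact continuous_pi fun k => continuous_pi fun l => continuous_aeval_ofReal (pderiv l (F k))

theorem aeval_ofReal {n : ℕ} (f : MvPolynomial (Fin n) ℚ) (x : Fin n → ℝ) :
    aeval (fun l => (x l : ℂ)) f = ((aeval x f : ℝ) : ℂ) :=
  (aeval_algebraMap_apply ℂ x f)

/-- The differential of a polynomial function on Euclidean space. -/
theorem hasStrictFDerivAt_aeval {n : ℕ} (f : MvPolynomial (Fin n) ℚ)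
    (x : EuclideanSpace ℝ (Fin n)) :
    HasStrictFDerivAt (fun y : EuclideanSpace ℝ (Fin n) => (aeval (fun l => y l) f : ℝ))
      (∑ l, (aeval (fun l => x l) (pderiv l f) : ℝ) • EuclideanSpace.proj (𝕜 := ℝ) l) x := by
  induction f using MvPolynomial.induction_on with
  | C a => simpa using hasStrictFDerivAt_const _ _
  | add f g hf hg =>
    simp only [map_add, add_smul, Finset.sum_add_distrib]
    exact hf.add hg
  | mul_X f j hf =>
    have hj := (EuclideanSpace.proj j : EuclideanSpace ℝ (Fin n) →L[ℝ] ℝ).hasStrictFDerivAt (x := x)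
    have h := hf.mul hj
    simp only [map_mul, aeval_X]
    convert! h using 1
    ext v
    simp [pderiv_X, Pi.single_apply, apply_ite, Derivation.leibniz, add_mul,
      Finset.sum_add_distrib, Finset.mul_sum]
    exact Finset.sum_congr rfl fun l _ => mul_assoc _ _ _

/-- Fermat's rule for the distance: at a real point `x` of the variety nearest to a point `b`, the
gradients of the equations and the vector `b - x` are linearly dependent. -/
theorem exists_multipliers_of_nearest {n p : ℕ} (F : Fin p → MvPolynomial (Fin n) ℚ)
    (b x : EuclideanSpace ℝ (Fin n)) (hx : ∀ k, (aeval (fun l => x l) (F k) : ℝ) = 0)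
    (hmin : ∀ y : EuclideanSpace ℝ (Fin n), (∀ k, (aeval (fun l => y l) (F k) : ℝ) = 0) →
      dist b x ≤ dist b y) :
    ∃ (Λ : Fin p → ℝ) (μ : ℝ), (Λ, μ) ≠ 0 ∧
      ∀ l, ∑ k, Λ k * aeval (fun l => x l) (pderiv l (F k)) + μ * (b l - x l) = 0 := by
  have hext : IsLocalExtrOn (fun y => ‖y - b‖ ^ 2)
      {y : EuclideanSpace ℝ (Fin n) | ∀ k, (aeval (fun l => y l) (F k) : ℝ) =
        aeval (fun l => x l) (F k)} x := by
    refine Or.inl (Filter.eventually_of_mem self_mem_nhdsWithin fun y hy => ?_)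
    have := hmin y fun k => (hy k).trans (hx k)
    rw [dist_eq_norm', dist_eq_norm'] at this
    dsimp only
    gcongr
  have hφ : HasStrictFDerivAt (fun y : EuclideanSpace ℝ (Fin n) => ‖y - b‖ ^ 2)
      ((2 • innerSL ℝ (x - b)).comp (ContinuousLinearMap.id ℝ _)) x :=
    (hasStrictFDerivAt_norm_sq (x - b)).comp x ((hasStrictFDerivAt_id x).sub_const b)
  obtain ⟨Λ, μ, hne, h⟩ := hext.exists_multipliers_of_hasStrictFDerivAt
    (fun k => hasStrictFDerivAt_aeval (F k) x) hφ
  -- The gradient of `‖y - b‖ ^ 2` at `x` is `2 (x - b) = -2 (b - x)`.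
  refine ⟨Λ, -2 * μ, ?_, fun l => ?_⟩
  · simpa [Prod.ext_iff] using hne
  · have hl := DFunLike.congr_fun h (EuclideanSpace.single l 1)
    simp [EuclideanSpace.inner_single_right] at hl
    linarith

/-- If the gradients of the equations and `a₁ - x` are linearly dependent at a real regular point
`x`, then `x` lies in the dual polar variety defined by `a`. -/
theorem mem_dualPolarVariety_of_multipliers {n p m : ℕ} {F : Fin p → MvPolynomial (Fin n) ℚ}
    {x : Fin n → ℝ} (hx : (fun l => (x l : ℂ)) ∈ regularPoints F)
    (a : Matrix (Fin m) (Fin n) ℝ) (j : Fin m) (Λ : Fin p → ℝ) (μ : ℝ) (hne : (Λ, μ) ≠ 0)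
    (h : ∀ l, ∑ k, Λ k * aeval x (pderiv l (F k)) + μ * (a j l - x l) = 0) :
    (fun l => (x l : ℂ)) ∈ dualPolarVariety F (addOnes (complexify a)) := by
  refine fun f hf => hf _ ⟨hx, fun c => ?_⟩
  rw [← Matrix.exists_vecMul_eq_zero_iff]
  -- The multipliers, padded by zeros outside row `j`, form a left kernel vector of the whole
  -- matrix, hence of every maximal minor.
  refine ⟨Sum.elim (fun k => (Λ k : ℂ)) (Pi.single j (μ : ℂ)), fun h0 => hne ?_, ?_⟩
  · refine Prod.ext (_root_.funext fun k => ?_) ?_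
    · simpa using congr_fun h0 (Sum.inl k)
    · simpa using congr_fun h0 (Sum.inr j)
  · ext q
    have hq := congr_arg Complex.ofReal (h (c q))
    simpa [Matrix.vecMul, dotProduct, dualPolarMatrix, jacobian, addOnes, complexify,
      aeval_ofReal, Pi.single_apply] using hq

/-- Every matrix with a row close enough to a real regular point defines a non-empty dual polar
variety. -/
theorem exists_forall_dist_lt_dualPolarVariety_nonempty {n p : ℕ}
    {F : Fin p → MvPolynomial (Fin n) ℚ} {x₀ : EuclideanSpace ℝ (Fin n)}
    (hx₀ : (fun l => (x₀ l : ℂ)) ∈ regularPoints F) :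
    ∃ ε > 0, ∀ (m : ℕ) (a : Matrix (Fin m) (Fin n) ℝ) (j : Fin m),
      dist (WithLp.toLp 2 (a j)) x₀ < ε →
        (dualPolarVariety F (addOnes (complexify a))).Nonempty := by
  obtain ⟨r, hr, hball⟩ := Metric.isOpen_iff.1 (isOpen_setOf_rank_jacobian F) x₀ hx₀.2
  refine ⟨r / 2, half_pos hr, fun m a j hj => ?_⟩
  let S : Set (EuclideanSpace ℝ (Fin n)) := {y | ∀ k, aeval (fun l => (y l : ℂ)) (F k) = 0}
  have hS : IsClosed S := by
    simp only [S, Set.ofPred_forall]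
    exact isClosed_iInter fun k => isClosed_eq (continuous_aeval_ofReal (F k)) continuous_const
  have hSreal : ∀ y ∈ S, ∀ k, (aeval (fun l => y l) (F k) : ℝ) = 0 := fun y hy k =>
    Complex.ofReal_eq_zero.1 ((aeval_ofReal (F k) _).symm.trans (hy k))
  obtain ⟨x, hxS, hx⟩ := hS.exists_infDist_eq_dist ⟨x₀, hx₀.1⟩ (WithLp.toLp 2 (a j))
  have hmin : ∀ y ∈ S, dist (WithLp.toLp 2 (a j)) x ≤ dist (WithLp.toLp 2 (a j)) y := fun y hy =>
    hx ▸ Metric.infDist_le_dist_of_mem hy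
  -- Since `x₀` competes for nearest point, `x` is within twice the distance from `a j` to `x₀`;
  -- hence the radius `r / 2`.
  have hxr : x ∈ Metric.ball x₀ r := by
    have h₁ := dist_triangle_left x x₀ (WithLp.toLp 2 (a j))
    have h₂ := hmin x₀ hx₀.1
    rw [Metric.mem_ball]
    linarith
  obtain ⟨Λ, μ, hne, h⟩ := exists_multipliers_of_nearest F (WithLp.toLp 2 (a j)) x (hSreal x hxS)
    fun y hy => hmin y fun k => by rw [aeval_ofReal, hy k, Complex.ofReal_zero]
  exact ⟨_, mem_dualPolarVariety_of_multipliers ⟨hxS, hball hxr⟩ a j Λ μ hne h⟩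

end PolarVariety


/-- "Generic" is meant in the sense of Thom: `a` (and the polar variety it defines) may be required
to have any prescribed property `P` that is valid for generic polar varieties. -/
theorem corollary2p3 {n p i : ℕ} (hp : 1 ≤ p) (hi : 1 ≤ i) (hin : i ≤ n - p)
    (F : Fin p → MvPolynomial (Fin n) ℚ) (hF : PolarVariety.IsReducedRegularSequence F)
    (hreg : ∃ x : Fin n → ℝ, (fun l => (x l : ℂ)) ∈ PolarVariety.regularPoints F)
    (P : Matrix (Fin (n - p - i + 1)) (Fin n) ℂ → Prop) (hP : PolarVariety.HoldsGenerically P) :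
    ∃ O : Set (Matrix (Fin (n - p - i + 1)) (Fin n) ℝ), IsOpen O ∧ O.Nonempty ∧
      ∀ a ∈ O, a.rank = n - p - i + 1 ∧
        P (PolarVariety.complexify a) ∧
        (PolarVariety.dualPolarVariety F
          (PolarVariety.addOnes (PolarVariety.complexify a))).Nonempty := by
  obtain ⟨x, hx⟩ := hreg
  obtain ⟨f, hf0, hf⟩ := hP.exists_ne_zero
  obtain ⟨ε, hε, hne⟩ :=
    PolarVariety.exists_forall_dist_lt_dualPolarVariety_nonempty (x₀ := WithLp.toLp 2 x) hx
  let U : Set (Matrix (Fin (n - p - i + 1)) (Fin n) ℝ) :=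
    {a | dist (WithLp.toLp 2 (a 0)) (WithLp.toLp 2 x) < ε}
  have hrow : Continuous fun a : Matrix (Fin (n - p - i + 1)) (Fin n) ℝ => WithLp.toLp 2 (a 0) :=
    (PiLp.continuous_toLp 2 _).comp (continuous_apply 0)
  have hU : IsOpen U := isOpen_lt (hrow.dist continuous_const) continuous_const
  have heval : Continuous fun a : Matrix (Fin (n - p - i + 1)) (Fin n) ℝ =>
      MvPolynomial.eval (fun e => (a e.1 e.2 : ℂ)) f :=
    f.continuous_eval.comp (continuous_pi fun e =>
      Complex.continuous_ofReal.comp (continuous_apply_apply e.1 e.2))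
  refine ⟨U ∩ {a | MvPolynomial.eval (fun e => (a e.1 e.2 : ℂ)) f ≠ 0},
    hU.inter (isOpen_ne_fun heval continuous_const), ?_, fun a ha =>
      ⟨(hf a ha.2).1, (hf a ha.2).2, hne _ a 0 ha.1⟩⟩
  -- This matrix with equal rows may have low rank and only shows that `U` is non-empty; a box
  -- around it inside `U` has infinite sides, so `f` is nonzero somewhere in it.
  have hxU : (Matrix.of fun _ => x) ∈ U := (dist_self (WithLp.toLp 2 x)).trans_lt hε
  obtain ⟨s, hs, hsU⟩ := isOpen_pi_iff'.1
    (hU.preimage (f := fun y : Fin (n - p - i + 1) × Fin n → ℝ => Matrix.of fun k l => y (k, l))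
      (continuous_pi fun k => continuous_pi fun l => continuous_apply (k, l)))
    (fun e => x e.2) hxU
  obtain ⟨y, hys, hy⟩ := PolarVariety.exists_eval_ofReal_ne_zero hf0 s fun e =>
    infinite_of_mem_nhds (x e.2) ((hs e).1.mem_nhds (hs e).2)
  exact ⟨Matrix.of fun k l => y (k, l), hsU fun e _ => hys e, hy⟩
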